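/- All Hilbert spaces are finite-dimensional and complex, and all outcome sets are finite. A quantum channel from $A$ to $B$ is a completely positive trace-preserving linear map $\mathcal L(\mathcal H_A)\to\mathcal L(\mathcal H_B)$; $\mathscr C(A\to B)$ is the set of them. A POVM on $A$ with outcome set $\mathcal X$ is a family $\mathsf E=\{E^x\}_{x\in\mathcal X}$ of positive semidefinite operators on $\mathcal H_A$ with $\sum_x E^x=\mathbb 1$. A CP-instrument is a family $\{\mathcal I^x\}_{x\in\mathcal X}$ of completely positive, trace non-increasing linear maps such that $\sum_x\mathcal I^x$ is trace preserving. A channel $\Lambda\in\mathscr C(A\to B)$ is a $\mathsf K$-channel (is compatible with the POVM $\mathsf K=\{K^x\}_{x\in\mathcal X}$) if there is a CP-instrument $\{\mathcal I^x\}_{x\in\mathcal X}$ from $A$ to $B$ with $\Lambda=\sum_x\mathcal I^x$ and $K^x=\mathcal I^{x\dagger}(\mathbb 1_B)$ for all $x$, where $\dagger$ is the adjoint for the Hilbert--Schmidt inner product $\langle Y,X\rangle=\mathrm{Tr}[Y^\dagger X]$. The robustness of measurement of $\mathsf E$ is $$R(\mathsf E)=\min\Big\{r\ge 0:\ \exists\text{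 a POVM }\{N^x\}_{x\in\mathcal X}\text{ and }q_x\ge 0,\ \sum_x q_x=1,\text{ with } \tfrac{E^x+rN^x}{1+r}=q_x\mathbb 1\ \ \forall x\Big\}.$$ The error between two POVMs with the same outcome set is $\epsilon(\mathsf E,\mathsf K)=\sum_{x}\|E^x-K^x\|$ (operator norm). The diamond norm distance of two channels is $\|\Lambda-\Xi\|_\diamond=\sup_{n\in\mathbb N}\sup_{\rho}\|(\Lambda\otimes\mathrm{id}_n)(\rho)-(\Xi\otimes\mathrm{id}_n)(\rho)\|_1$, where $\rho$ ranges over the density operators on $\mathcal H_A\otimes\mathbb C^n$ and $\|\cdot\|_1$ is the trace norm. The disturbance of a channel is $\delta(\Lambda)=\inf_{\mathcal R\in\mathscr C(B\to A)}\|\mathcal R\circ\Lambda-\mathrm{id}_A\|_\diamond$. Theorem. Let $\mathsf E,\mathsf K$ be POVMs on $A$ with the same outcome set $\mathcal X$, and let $d=\dim\mathcal H_A\ge 2$. For every system $B$ and every $\mathsf K$-channel $\Lambda\in\mathscr C(A\to B)$, $$\frac{2\big(\sqrt{R(\mathsf E)+1}-1\big)^2}{d-1}\ \le\ \epsilon(\mathsf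 E,\mathsf K)+\delta(\Lambda).$$ -/

import Mathlib

open scoped ComplexOrder MatrixOrder Matrix Kronecker Matrix.Norms.L2Operator

/-! Finite-dimensional quantum systems in coordinates: a system with Hilbert space `ℂ^a` is a finite
index type `a`, its operators are the matrices `Matrix a a ℂ`, its dimension is `Fintype.card a`,
and the composite of two systems is the product of the index types. -/

namespace QuantumInfo

noncomputable section

/-- Operators on the system `a`. -/
abbrev Op (a : Type*) := Matrix a a ℂ

/-- Linear maps (superoperators) from operators on `a` to operators on `b`. -/
abbrev SuperOp (a b : Type*) := Op a →ₗ[ℂ] Op b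

/-- The map `Φ ⊗ id_k`: the map `Φ` applied to each of the `a`-blocks of an operator on `a ⊗ k`. -/
def ampliation {a b : Type*} (k : Type*) (Φ : SuperOp a b) : SuperOp (a × k) (b × k) where
  toFun M := Matrix.of fun p q =>
    Φ (Matrix.of fun i j => M (i, p.2) (j, q.2)) p.1 q.1
  map_add' M N := by
    ext p q
    exact congrFun (congrFun (map_add Φ (Matrix.of fun i j => M (i, p.2) (j, q.2))
      (Matrix.of fun i j => N (i, p.2) (j, q.2))) p.1) q.1
  map_smul' c M := by
    ext p q
    exact congrFun (congrFun (map_smul Φ c (Matrix.of fun i j => M (i, p.2) (j, q.2))) p.1) q.1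

/-- On product operators `ampliation` acts as `Φ ⊗ id`. -/
theorem ampliation_kronecker {a b k : Type*} (Φ : SuperOp a b) (A : Op a) (N : Op k) :
    ampliation k Φ (A ⊗ₖ N) = Φ A ⊗ₖ N := by
  ext p q
  have h : (Matrix.of fun i j => (A ⊗ₖ N) (i, p.2) (j, q.2)) = N p.2 q.2 • A := by
    ext i j
    simp [Matrix.kroneckerMap_apply, mul_comm]
  simp only [ampliation, LinearMap.coe_mk, AddHom.coe_mk, Matrix.of_apply]
  rw [h, map_smul]
  simp [Matrix.kroneckerMap_apply, mul_comm]

/-- Complete positivity: `Φ ⊗ id_n` maps positive operators to positive operators for every `n`. -/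
def IsCompletelyPositive {a b : Type*} (Φ : SuperOp a b) : Prop :=
  ∀ (n : ℕ) (M : Op (a × Fin n)), M.PosSemidef → (ampliation (Fin n) Φ M).PosSemidef

/-- Trace preservation. -/
def IsTracePreserving {a b : Type*} [Fintype a] [Fintype b] (Φ : SuperOp a b) : Prop :=
  ∀ M : Op a, (Φ M).trace = M.trace

/-- Trace non-increase (on positive operators). -/
def IsTraceNonincreasing {a b : Type*} [Fintype a] [Fintype b] (Φ : SuperOp a b) : Prop :=
  ∀ M : Op a, M.PosSemidef → (Φ M).trace.re ≤ M.trace.re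

/-- Quantum channels: completely positive trace-preserving linear maps. -/
def IsChannel {a b : Type*} [Fintype a] [Fintype b] (Φ : SuperOp a b) : Prop :=
  IsCompletelyPositive Φ ∧ IsTracePreserving Φ

/-- Density operators. -/
def IsState {a : Type*} [Fintype a] (ρ : Op a) : Prop :=
  ρ.PosSemidef ∧ ρ.trace = 1

/-- POVMs on `a` with finite outcome set `X`. -/
def IsPOVM {a X : Type*} [DecidableEq a] [Fintype X] (E : X → Op a) : Prop :=
  (∀ x, (E x).PosSemidef) ∧ ∑ x, E x = 1

/-- CP-instruments with finite outcome set `X`. -/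
def IsInstrument {a b X : Type*} [Fintype a] [Fintype b] [Fintype X]
    (I : X → SuperOp a b) : Prop :=
  (∀ x, IsCompletelyPositive (I x) ∧ IsTraceNonincreasing (I x)) ∧ IsTracePreserving (∑ x, I x)

/-- The adjoint `Φ†` for the Hilbert–Schmidt inner product `⟨Y, X⟩ = Tr[Yᴴ X]`. -/
def hsAdjoint {a b : Type*} [DecidableEq a] [Fintype b] (Φ : SuperOp a b) : SuperOp b a where
  toFun Y := Matrix.of fun i j => star ((Yᴴ * Φ (Matrix.single i j 1)).trace)
  map_add' Y Z := by
    ext i j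
    simp [Matrix.add_mul]
  map_smul' c Y := by
    ext i j
    simp

/-- The defining property of the adjoint: `⟨Φ†(Y), M⟩ = ⟨Y, Φ(M)⟩`. -/
theorem hsAdjoint_spec {a b : Type*} [Fintype a] [DecidableEq a] [Fintype b]
    (Φ : SuperOp a b) (Y : Op b) (M : Op a) :
    ((hsAdjoint Φ Y)ᴴ * M).trace = (Yᴴ * Φ M).trace := by
  conv_rhs => rw [Matrix.matrix_eq_sum_single M]
  have h : ∀ i j, Matrix.single i j (M i j) = M i j • Matrix.single i j (1 : ℂ) := by
    intro i j
    simp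
  simp only [h, map_sum, map_smul, Matrix.mul_sum, Matrix.trace_sum, Matrix.mul_smul,
    Matrix.trace_smul]
  rw [Finset.sum_comm]
  simp [Matrix.trace, Matrix.mul_apply, hsAdjoint, mul_comm]

/-- `Λ` and `E` are compatible (for a channel `Λ` and a POVM `E`: `Λ` is an `E`-channel): some
CP-instrument has total map `Λ` and induces `E`. -/
def IsCompatible {a b X : Type*} [Fintype a] [DecidableEq a] [Fintype b] [DecidableEq b]
    [Fintype X] (Λ : SuperOp a b) (E : X → Op a) : Prop :=
  ∃ I : X → SuperOp a b, IsInstrument I ∧ Λ = ∑ x, I x ∧ ∀ x, E x = hsAdjoint (I x) 1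

/-- The trace norm `‖M‖₁ = Tr √(Mᴴ M)`. -/
def traceNorm {a : Type*} [Fintype a] [DecidableEq a] (M : Op a) : ℝ :=
  (CFC.sqrt (Mᴴ * M)).trace.re

/-- The diamond norm distance `‖Λ - Ξ‖_⋄` of two channels. -/
def diamondDist {a b : Type*} [Fintype a] [Fintype b] [DecidableEq b] (Λ Ξ : SuperOp a b) : ℝ :=
  sSup {t : ℝ | ∃ (n : ℕ) (ρ : Op (a × Fin n)), IsState ρ ∧
    t = traceNorm (ampliation (Fin n) Λ ρ - ampliation (Fin n) Ξ ρ)}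

/-- The disturbance `δ(Λ) = inf_𝓡 ‖𝓡 ∘ Λ - id‖_⋄`, over all recovery channels `𝓡` from `b` to `a`. -/
def disturbance {a b : Type*} [Fintype a] [DecidableEq a] [Fintype b] (Λ : SuperOp a b) : ℝ :=
  ⨅ R : {R : SuperOp b a // IsChannel R}, diamondDist (R.1 ∘ₗ Λ) LinearMap.id

/-- The error `ε(E, K) = ∑ x, ‖E x - K x‖`, with the operator norm. -/
def povmError {a X : Type*} [Fintype a] [DecidableEq a] [Fintype X] (E K : X → Op a) : ℝ :=
  ∑ x, ‖E x - K x‖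

/-- The noise amounts `r ≥ 0` for which some POVM `N`, mixed into `E` with relative weight `r`,
produces a trivial POVM `{q x • 1}`. -/
def robustnessSet {a X : Type*} [DecidableEq a] [Fintype X] (E : X → Op a) : Set ℝ :=
  {r : ℝ | 0 ≤ r ∧ ∃ (N : X → Op a) (q : X → ℝ), IsPOVM N ∧ (∀ x, 0 ≤ q x) ∧ ∑ x, q x = 1 ∧
    ∀ x, (1 + r)⁻¹ • (E x + r • N x) = q x • (1 : Op a)}

/-- The robustness of measurement `R(E)`: the least element of `robustnessSet E` (for a POVM on a
nonzero space this set is nonempty and closed, so the infimum is a minimum). -/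
def robustness {a X : Type*} [DecidableEq a] [Fintype X] (E : X → Op a) : ℝ :=
  sInf (robustnessSet E)

end

end QuantumInfo

/-!
Write `d = dim a` and `S(E) = ∑ x, ‖E x‖`. Three facts give the bound.

* `IsPOVM.robustness_add_one_le`: `R(E) + 1 ≤ S(E)`, by exhibiting the noise that makes `E` trivial.

* For every `K`-channel `Λ` and every recovery `R`, the channel `Ξ = R ∘ Λ` is a sum of completely
  positive maps `J x` that still induce `K`. Feeding half of a maximally entangled state into `Ξ`
  shows that the diamond distance of `Ξ` from the identity is at least twice the infidelity
  `1 - F`, where `F` is the entanglement fidelity of `Ξ`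
  (`two_mul_one_sub_entFidelity_le_diamondDist`). For a Kraus operator `A` of `J x` the
  fidelity involves `|Tr A|²`; splitting the trace along a top eigenvector of `K x` and its
  complement, Cauchy–Schwarz gives
  `d² F ≤ (1 + s) S(K) + (1 + 1/s) (d - 1) (d - S(K))` for all `s > 0`
  (`IsCompletelyPositive.entFidelity_le`, `IsPOVM.entFidelity_sum_le`). Optimising over `s`, one
  finds `1 - F ≥ (√S(K) - 1)² / (d - 1)` (`sq_sub_one_div_le`).

* `S(E) ≤ S(K) + ε(E, K)` by the triangle inequality, and `S ↦ 2 (√S - 1)² / (d - 1)` has slope at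
  most one on `[1, d]` (`two_mul_sq_sub_one_div_le_add`), so passing from `K` to `E` costs at most
  `ε(E, K)`.
-/

namespace QuantumInfo

open Matrix

/-! ### Traces and the trace norm -/

theorem trace_mul_re_nonneg {a : Type*} [Fintype a] {A B : Op a} (hA : A.PosSemidef)
    (hB : B.PosSemidef) : 0 ≤ (A * B).trace.re := by
  classical
  obtain ⟨C, hC⟩ := CStarAlgebra.nonneg_iff_eq_star_mul_self.mp hA.nonneg
  have h := (hB.mul_mul_conjTranspose_same C).trace_nonneg
  rw [hC, star_eq_conjTranspose, Matrix.trace_mul_comm, ← Matrix.mul_assoc,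
    Matrix.trace_mul_comm, ← Matrix.mul_assoc]
  exact (Complex.le_def.mp h).1

theorem trace_conjTranspose_mul_self_re {a b : Type*} [Fintype a] [Fintype b]
    (M : Matrix b a ℂ) : (Mᴴ * M).trace.re = ∑ i, ∑ j, ‖M j i‖ ^ 2 := by
  simp only [Matrix.trace, Matrix.diag_apply, Matrix.mul_apply, conjTranspose_apply,
    Complex.re_sum]
  refine Finset.sum_congr rfl fun i _ => Finset.sum_congr rfl fun j _ => ?_
  rw [← Complex.normSq_eq_norm_sq, Complex.normSq_apply]
  simp

/-- The Cauchy–Schwarz inequality for the Hilbert–Schmidt inner product. -/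
theorem norm_trace_conjTranspose_mul_sq_le {a b : Type*} [Fintype a] [Fintype b]
    (M N : Matrix b a ℂ) :
    ‖(Mᴴ * N).trace‖ ^ 2 ≤ (Mᴴ * M).trace.re * (Nᴴ * N).trace.re := by
  have h1 : ‖(Mᴴ * N).trace‖ ≤ ∑ p : a × b, ‖M p.2 p.1‖ * ‖N p.2 p.1‖ := by
    rw [Fintype.sum_prod_type]
    simp only [Matrix.trace, Matrix.diag_apply, Matrix.mul_apply, conjTranspose_apply]
    refine (norm_sum_le _ _).trans (Finset.sum_le_sum fun i _ => ?_)
    refine (norm_sum_le _ _).trans (Finset.sum_le_sum fun j _ => ?_)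
    rw [norm_mul, norm_star]
  calc ‖(Mᴴ * N).trace‖ ^ 2 ≤ (∑ p : a × b, ‖M p.2 p.1‖ * ‖N p.2 p.1‖) ^ 2 := by gcongr
    _ ≤ (∑ p : a × b, ‖M p.2 p.1‖ ^ 2) * ∑ p : a × b, ‖N p.2 p.1‖ ^ 2 :=
      Finset.sum_mul_sq_le_sq_mul_sq _ _ _
    _ = _ := by
      rw [trace_conjTranspose_mul_self_re, trace_conjTranspose_mul_self_re,
        Fintype.sum_prod_type, Fintype.sum_prod_type]

/-- One half of the variational formula `‖H‖₁ = max {Tr (U H) | -1 ≤ U ≤ 1}`. -/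
theorem trace_mul_re_le_traceNorm {a : Type*} [Fintype a] [DecidableEq a] {H U : Op a}
    (hH : H.IsHermitian) (h₁ : (1 - U).PosSemidef) (h₂ : (1 + U).PosSemidef) :
    (U * H).trace.re ≤ traceNorm H := by
  have hs : IsSelfAdjoint H := hH
  have e₁ : traceNorm H = (H⁺ + H⁻).trace.re := by
    rw [CFC.posPart_add_negPart H hs]; rfl
  have e₂ : U * H = U * (H⁺ - H⁻) := by rw [CFC.posPart_sub_negPart H hs]
  have p₁ := trace_mul_re_nonneg h₁ (nonneg_iff_posSemidef.mp (CFC.posPart_nonneg H))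
  have p₂ := trace_mul_re_nonneg h₂ (nonneg_iff_posSemidef.mp (CFC.negPart_nonneg H))
  rw [e₁, e₂]
  simp only [sub_mul, add_mul, mul_sub, one_mul, trace_sub, trace_add, Complex.sub_re,
    Complex.add_re] at *
  linarith

theorem traceNorm_sub_le {a : Type*} [Fintype a] [DecidableEq a] {ρ σ : Op a}
    (hρ : ρ.PosSemidef) (hσ : σ.PosSemidef) :
    traceNorm (ρ - σ) ≤ ρ.trace.re + σ.trace.re := by
  have hs : IsSelfAdjoint (ρ - σ) := hρ.isHermitian.sub hσ.isHermitian
  have hc : ∀ f : ℝ → ℝ, ContinuousOn f (spectrum ℝ (ρ - σ)) := fun f =>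
    (finite_real_spectrum (A := ρ - σ)).continuousOn f
  -- `U` is the sign of `ρ - σ`, so that `|ρ - σ| = U (ρ - σ)` and `-1 ≤ U ≤ 1`.
  let s : ℝ → ℝ := fun x => if 0 ≤ x then 1 else -1
  let U : Op a := cfc s (ρ - σ)
  have hU : CFC.abs (ρ - σ) = U * (ρ - σ) := by
    have hmul := cfc_mul s (fun x => x) (ρ - σ) (hc _) (hc _)
    rw [cfc_id' ℝ (ρ - σ) hs] at hmul
    rw [CFC.abs_eq_cfc_norm (ρ - σ) hs, ← hmul]
    refine cfc_congr fun x _ => ?_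
    simp only [s, Real.norm_eq_abs]
    split_ifs with h
    · rw [abs_of_nonneg h, one_mul]
    · rw [abs_of_neg (not_le.mp h)]; ring
  have h₁ : (1 - U).PosSemidef := by
    rw [← Matrix.le_iff]
    exact cfc_le_one s (ρ - σ) fun x _ => by simp only [s]; split_ifs <;> norm_num
  have h₂ : (1 + U).PosSemidef := by
    have : (-1 : Op a) ≤ U := by
      have := algebraMap_le_cfc s (-1) (ρ - σ)
        (fun x _ => by simp only [s]; split_ifs <;> norm_num) (hc _) hs
      simpa using this
    rw [Matrix.le_iff, sub_neg_eq_add, add_comm] at this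
    exact this
  have p₁ := trace_mul_re_nonneg h₁ hρ
  have p₂ := trace_mul_re_nonneg h₂ hσ
  have e : traceNorm (ρ - σ) = (U * (ρ - σ)).trace.re := by rw [← hU]; rfl
  rw [e]
  simp only [sub_mul, add_mul, mul_sub, one_mul, trace_sub, trace_add, Complex.sub_re,
    Complex.add_re] at *
  linarith

/-! ### Ampliations and channels -/

theorem ampliation_id {a : Type*} (k : Type*) (M : Op (a × k)) :
    ampliation k (LinearMap.id : SuperOp a a) M = M := rfl

theorem IsCompletelyPositive.comp {a b c : Type*} {Ψ : SuperOp b c} {Φ : SuperOp a b}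
    (hΨ : IsCompletelyPositive Ψ) (hΦ : IsCompletelyPositive Φ) :
    IsCompletelyPositive (Ψ ∘ₗ Φ) :=
  fun n M hM => hΨ n _ (hΦ n M hM)

theorem IsChannel.comp {a b c : Type*} [Fintype a] [Fintype b] [Fintype c] {Ψ : SuperOp b c}
    {Φ : SuperOp a b} (hΨ : IsChannel Ψ) (hΦ : IsChannel Φ) : IsChannel (Ψ ∘ₗ Φ) :=
  ⟨hΨ.1.comp hΦ.1, fun M => (hΨ.2 _).trans (hΦ.2 M)⟩

theorem IsTracePreserving.trace_ampliation {a b k : Type*} [Fintype a] [Fintype b] [Fintype k]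
    {Φ : SuperOp a b} (hΦ : IsTracePreserving Φ) (M : Op (a × k)) :
    (ampliation k Φ M).trace = M.trace := by
  simp only [Matrix.trace, Matrix.diag_apply, Fintype.sum_prod_type_right]
  exact Finset.sum_congr rfl fun i _ => hΦ (Matrix.of fun p q => M (p, i) (q, i))

/-- The channel that discards its input and prepares a basis state. -/
theorem exists_isChannel {a b : Type*} [Fintype a] [Nonempty a] [Fintype b] :
    ∃ R : SuperOp b a, IsChannel R := by
  classical
  obtain ⟨i⟩ := ‹Nonempty a›
  refine ⟨LinearMap.smulRight (Matrix.traceLinearMap b ℂ ℂ) (Matrix.single i i 1), ?_, ?_⟩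
  · intro n M hM
    have hT : (∑ j : b, M.submatrix (fun k : Fin n => (j, k)) fun k => (j, k)).PosSemidef :=
      Matrix.posSemidef_sum _ fun j _ => hM.submatrix _
    have hS : (Matrix.single i i (1 : ℂ)).PosSemidef := by
      rw [← Matrix.diagonal_single]
      exact Matrix.PosSemidef.diagonal (Pi.single_nonneg.mpr zero_le_one)
    have e : ampliation (Fin n) (LinearMap.smulRight (Matrix.traceLinearMap b ℂ ℂ)
        (Matrix.single i i 1)) M = Matrix.single i i (1 : ℂ) ⊗ₖ
          ∑ j : b, M.submatrix (fun k : Fin n => (j, k)) fun k => (j, k) := by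
      ext p q
      simp [ampliation, Matrix.kroneckerMap_apply, Matrix.trace, Matrix.sum_apply, mul_comm]
    rw [e]
    exact hS.kronecker hT
  · intro M
    simp

theorem traceNorm_le_diamondDist {a b : Type*} [Fintype a] [Fintype b] [DecidableEq b]
    {Λ Ξ : SuperOp a b} (hΛ : IsChannel Λ) (hΞ : IsChannel Ξ) {n : ℕ} {ρ : Op (a × Fin n)}
    (hρ : IsState ρ) :
    traceNorm (ampliation (Fin n) Λ ρ - ampliation (Fin n) Ξ ρ) ≤ diamondDist Λ Ξ := by
  refine le_csSup ⟨2, ?_⟩ ⟨n, ρ, hρ, rfl⟩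
  rintro t ⟨m, σ, hσ, rfl⟩
  refine (traceNorm_sub_le (hΛ.1 m σ hσ.1) (hΞ.1 m σ hσ.1)).trans ?_
  rw [hΛ.2.trace_ampliation, hΞ.2.trace_ampliation, hσ.2]
  norm_num

theorem isChannel_id {a : Type*} [Fintype a] : IsChannel (LinearMap.id : SuperOp a a) :=
  ⟨fun _ _ hM => hM, fun _ => rfl⟩

/-! ### The entanglement fidelity -/

/-- The unnormalised entanglement fidelity `⟨Ω|(Φ ⊗ id)(|Ω⟩⟨Ω|)|Ω⟩` with `Ω = ∑ i, e i ⊗ e i`: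
it is `(dim a)²` times the overlap of the maximally entangled state with its image. -/
noncomputable def entFidelity {a : Type*} [Fintype a] [DecidableEq a] : SuperOp a a →ₗ[ℂ] ℂ where
  toFun Φ := ∑ i, ∑ j, Φ (Matrix.single i j 1) i j
  map_add' Φ Ψ := by simp [Finset.sum_add_distrib]
  map_smul' c Φ := by simp [Finset.mul_sum]

/-- The unnormalised maximally entangled vector `∑ i, e i ⊗ e i`, with the second factor relabelled
by `Fin (card a)`, the form in which ancillas enter complete positivity and the diamond norm. -/
noncomputable def maxEntangled (a : Type*) [Fintype a] : a × Fin (Fintype.card a) → ℂ :=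
  open Classical in fun p => if Fintype.equivFin a p.1 = p.2 then 1 else 0

/-- The Choi matrix of `Φ` lists the images of the matrix units. -/
theorem ampliation_maxEntangled_apply {a b : Type*} [Fintype a] [DecidableEq a]
    (Φ : SuperOp a b) (i j : b) (k l : a) :
    ampliation (Fin (Fintype.card a)) Φ (vecMulVec (maxEntangled a) (star (maxEntangled a)))
      (i, Fintype.equivFin a k) (j, Fintype.equivFin a l) = Φ (Matrix.single k l 1) i j := by
  simp only [ampliation, LinearMap.coe_mk, AddHom.coe_mk, of_apply]
  refine congrArg (fun M => Φ M i j) ?_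
  ext p q
  simp only [Matrix.single_apply, of_apply, Matrix.vecMulVec_apply, maxEntangled, Pi.star_apply,
    EmbeddingLike.apply_eq_iff_eq, eq_comm (a := k), eq_comm (a := l)]
  by_cases h₁ : p = k <;> by_cases h₂ : q = l <;> simp [h₁, h₂]

/-- Kraus decomposition, read off from a factorisation of the Choi matrix. -/
theorem IsCompletelyPositive.exists_kraus {a b : Type*} [Fintype a] [Fintype b]
    {Φ : SuperOp a b} (hΦ : IsCompletelyPositive Φ) :
    ∃ A : b × a → Matrix b a ℂ, ∀ M, Φ M = ∑ m, A m * M * (A m)ᴴ := by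
  classical
  have hC := (hΦ _ _ (Matrix.posSemidef_vecMulVec_self_star (maxEntangled a))).submatrix
    (fun p : b × a => (p.1, Fintype.equivFin a p.2))
  obtain ⟨C, hC⟩ := CStarAlgebra.nonneg_iff_eq_star_mul_self.mp hC.nonneg
  have key : ∀ i j k l, Φ (Matrix.single k l 1) i j = ∑ m, star (C m (i, k)) * C m (j, l) := by
    intro i j k l
    have h := congrFun (congrFun hC (i, k)) (j, l)
    rw [star_eq_conjTranspose, Matrix.mul_apply] at h
    simp only [conjTranspose_apply] at h
    rw [← h, submatrix_apply, ampliation_maxEntangled_apply]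
  refine ⟨fun m => Matrix.of fun i k => star (C m (i, k)), fun M => ?_⟩
  have h : ∀ k l, Matrix.single k l (M k l) = M k l • Matrix.single k l (1 : ℂ) := by simp
  ext i j
  conv_lhs => rw [Matrix.matrix_eq_sum_single M]
  simp only [h, map_sum, map_smul, Matrix.sum_apply, Matrix.smul_apply, key, smul_eq_mul,
    Matrix.mul_apply, of_apply, conjTranspose_apply, star_star, Finset.mul_sum, Finset.sum_mul]
  rw [Finset.sum_congr rfl fun k _ => Finset.sum_comm, Finset.sum_comm]
  refine Finset.sum_congr rfl fun m _ => ?_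
  rw [Finset.sum_comm]
  exact Finset.sum_congr rfl fun l _ => Finset.sum_congr rfl fun k _ => by ring

theorem entFidelity_of_kraus {a ι : Type*} [Fintype a] [DecidableEq a] [Fintype ι]
    {Φ : SuperOp a a} {A : ι → Op a} (hA : ∀ M, Φ M = ∑ m, A m * M * (A m)ᴴ) :
    entFidelity Φ = ((∑ m, ‖(A m).trace‖ ^ 2 : ℝ) : ℂ) := by
  have h : ∀ i j, Φ (Matrix.single i j 1) i j = ∑ m, A m i i * star (A m j j) := by
    intro i j
    rw [hA, Matrix.sum_apply]
    refine Finset.sum_congr rfl fun m _ => ?_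
    simp [Matrix.mul_apply, Matrix.single_apply, ite_and]
  have hm : ∀ m, (((‖(A m).trace‖ ^ 2 : ℝ)) : ℂ) = (A m).trace * star (A m).trace := by
    intro m
    rw [← Complex.normSq_eq_norm_sq]
    exact (Complex.mul_conj _).symm
  simp only [entFidelity, LinearMap.coe_mk, AddHom.coe_mk, h, Complex.ofReal_sum, hm]
  simp only [Matrix.trace, Matrix.diag_apply, star_sum, Finset.sum_mul_sum]
  rw [Finset.sum_congr rfl fun k _ => Finset.sum_comm, Finset.sum_comm]

theorem norm_add_sq_le_of_pos (z w : ℂ) {s : ℝ} (hs : 0 < s) :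
    ‖z + w‖ ^ 2 ≤ (1 + s) * ‖z‖ ^ 2 + (1 + s⁻¹) * ‖w‖ ^ 2 := by
  have h : ‖z + w‖ ^ 2 ≤ (‖z‖ + ‖w‖) ^ 2 := by gcongr; exact norm_add_le z w
  have e : (1 + s) * ‖z‖ ^ 2 + (1 + s⁻¹) * ‖w‖ ^ 2 - (‖z‖ + ‖w‖) ^ 2
      = s⁻¹ * (s * ‖z‖ - ‖w‖) ^ 2 := by field_simp; ring
  have : 0 ≤ s⁻¹ * (s * ‖z‖ - ‖w‖) ^ 2 := by positivity
  linarith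

/-- If a completely positive map is probed with an orthogonal projection `P` and its complement,
the entanglement fidelity is bounded by the two probabilities. The trace of each Kraus operator `A`
splits as `Tr (P A) + Tr ((1 - P) A)`, and Cauchy–Schwarz bounds both parts; the parameter `s`
weights the cross term. -/
theorem IsCompletelyPositive.entFidelity_le {a : Type*} [Fintype a] [DecidableEq a]
    {Φ : SuperOp a a} (hΦ : IsCompletelyPositive Φ) {P : Op a} (hP : P.IsHermitian)
    (hPP : P * P = P) {s : ℝ} (hs : 0 < s) :
    (entFidelity Φ).re ≤ (1 + s) * (P.trace.re * (Φ P).trace.re) +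
      (1 + s⁻¹) * ((1 - P).trace.re * (Φ (1 - P)).trace.re) := by
  obtain ⟨A, hA⟩ := hΦ.exists_kraus
  have cs : ∀ Q : Op a, Q.IsHermitian → Q * Q = Q → ∀ m,
      ‖(Q * A m).trace‖ ^ 2 ≤ Q.trace.re * (A m * Q * (A m)ᴴ).trace.re := by
    intro Q hQ hQQ m
    have h := norm_trace_conjTranspose_mul_sq_le Q (A m * Q)
    have e₁ : (Qᴴ * (A m * Q)).trace = (Q * A m).trace := by
      rw [hQ.eq, Matrix.trace_mul_comm, Matrix.mul_assoc, hQQ, Matrix.trace_mul_comm]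
    have e₂ : ((A m * Q)ᴴ * (A m * Q)).trace = (A m * Q * (A m)ᴴ).trace := by
      rw [Matrix.trace_mul_comm, conjTranspose_mul, hQ.eq, ← Matrix.mul_assoc,
        Matrix.mul_assoc (A m), hQQ]
    rwa [e₁, e₂, hQ.eq, hQQ] at h
  have tr : ∀ Q : Op a, (Φ Q).trace.re = ∑ m, (A m * Q * (A m)ᴴ).trace.re := by
    intro Q
    rw [hA, Matrix.trace_sum, Complex.re_sum]
  rw [entFidelity_of_kraus hA, Complex.ofReal_re, tr, tr, Finset.mul_sum, Finset.mul_sum,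
    Finset.mul_sum, Finset.mul_sum, ← Finset.sum_add_distrib]
  refine Finset.sum_le_sum fun m _ => ?_
  have hQ : (1 - P).IsHermitian := Matrix.isHermitian_one.sub hP
  have hQQ : (1 - P) * (1 - P) = 1 - P := IsIdempotentElem.one_sub hPP
  have e : (A m).trace = (P * A m).trace + ((1 - P) * A m).trace := by
    rw [← Matrix.trace_add, ← add_mul, add_sub_cancel, one_mul]
  rw [e]
  refine (norm_add_sq_le_of_pos _ _ hs).trans ?_
  have := cs P hP hPP m
  have := cs (1 - P) hQ hQQ m
  gcongr

theorem dotProduct_star_maxEntangled (a : Type*) [Fintype a] :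
    star (maxEntangled a) ⬝ᵥ maxEntangled a = (Fintype.card a : ℂ) := by
  classical
  simp only [dotProduct, maxEntangled, Pi.star_apply, Fintype.sum_prod_type]
  simp

theorem trace_vecMulVec_maxEntangled_mul {a : Type*} [Fintype a]
    (M : Op (a × Fin (Fintype.card a))) :
    (vecMulVec (maxEntangled a) (star (maxEntangled a)) * M).trace =
      ∑ i, ∑ j, M (i, Fintype.equivFin a i) (j, Fintype.equivFin a j) := by
  rw [vecMulVec_mul, trace_vecMulVec]
  simp [dotProduct, vecMul, maxEntangled, Fintype.sum_prod_type]
  rw [Finset.sum_comm]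

/-- The maximally entangled state as input: the distance of a pure state from its image is at least
twice the infidelity. -/
theorem two_mul_one_sub_entFidelity_le_diamondDist {a : Type*} [Fintype a] [DecidableEq a]
    [Nonempty a] {Ξ : SuperOp a a} (hΞ : IsChannel Ξ) :
    2 * (1 - (entFidelity Ξ).re / (Fintype.card a : ℝ) ^ 2) ≤ diamondDist Ξ LinearMap.id := by
  set d := Fintype.card a with hd
  have hd0 : (d : ℂ) ≠ 0 := by simp [hd]
  set W := vecMulVec (maxEntangled a) (star (maxEntangled a)) with hW
  set ρ : Op (a × Fin d) := (d : ℂ)⁻¹ • W with hρ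
  have hWW : W * W = (d : ℂ) • W := by
    rw [hW, vecMulVec_mul_vecMulVec, dotProduct_star_maxEntangled, vecMulVec_smul]
  have hρρ : ρ * ρ = ρ := by
    rw [hρ, smul_mul_smul_comm, hWW, smul_smul, mul_assoc, inv_mul_cancel₀ hd0, mul_one]
  have hpos : ρ.PosSemidef :=
    (posSemidef_vecMulVec_self_star _).smul (by positivity)
  have htr : ρ.trace = 1 := by
    rw [hρ, trace_smul, hW, trace_vecMulVec, dotProduct_comm, dotProduct_star_maxEntangled,
      smul_eq_mul, inv_mul_cancel₀ hd0]
  refine le_trans ?_ (traceNorm_le_diamondDist hΞ isChannel_id ⟨hpos, htr⟩)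
  have hfid : (ρ * ampliation (Fin d) Ξ ρ).trace = entFidelity Ξ / (d : ℂ) ^ 2 := by
    rw [hρ, map_smul, smul_mul_smul_comm, trace_smul, hW, trace_vecMulVec_maxEntangled_mul]
    have e : entFidelity Ξ = ∑ i, ∑ j, Ξ (Matrix.single i j 1) i j := rfl
    simp_rw [e, ← ampliation_maxEntangled_apply, smul_eq_mul]
    rw [div_eq_inv_mul, pow_two, mul_inv]
  have h₁ : (1 - (1 - (2 : ℂ) • ρ)).PosSemidef := by
    rw [sub_sub_cancel]
    exact hpos.smul zero_le_two
  have h₂ : (1 + (1 - (2 : ℂ) • ρ)).PosSemidef := by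
    have e : 1 + (1 - (2 : ℂ) • ρ) = (2 : ℂ) • ((1 - ρ)ᴴ * (1 - ρ)) := by
      rw [(isHermitian_one.sub hpos.isHermitian).eq, (IsIdempotentElem.one_sub hρρ).eq]
      module
    rw [e]
    exact (posSemidef_conjTranspose_mul_self _).smul zero_le_two
  have hH : (ampliation (Fin d) Ξ ρ - ρ).IsHermitian :=
    (hΞ.1 _ _ hpos).isHermitian.sub hpos.isHermitian
  refine le_trans (le_of_eq ?_) (trace_mul_re_le_traceNorm hH h₁ h₂)
  have e : ((1 - (2 : ℂ) • ρ) * (ampliation (Fin d) Ξ ρ - ρ)).trace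
      = 2 * (1 - entFidelity Ξ / (d : ℂ) ^ 2) := by
    simp only [sub_mul, mul_sub, one_mul, trace_sub, smul_mul, trace_smul, hρρ, hfid, htr,
      hΞ.2.trace_ampliation, smul_eq_mul]
    ring
  rw [ampliation_id, e]
  have : ((entFidelity Ξ / (d : ℂ) ^ 2)).re = (entFidelity Ξ).re / (d : ℝ) ^ 2 := by
    rw [← Complex.div_ofReal_re]; push_cast; rfl
  simp [this]

/-! ### POVMs -/

/-- The norm of a positive operator is attained on a rank-one projection. -/
theorem exists_projection_trace_mul_eq_norm {a : Type*} [Fintype a] [DecidableEq a] [Nonempty a]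
    {K : Op a} (hK : K.PosSemidef) :
    ∃ P : Op a, P.PosSemidef ∧ P * P = P ∧ P.trace = 1 ∧ (K * P).trace.re = ‖K‖ := by
  have h := CStarAlgebra.norm_mem_spectrum_of_nonneg hK.nonneg
  rw [hK.isHermitian.spectrum_real_eq_range_eigenvalues] at h
  obtain ⟨i, hi⟩ := h
  set v : a → ℂ := ⇑(hK.isHermitian.eigenvectorBasis i) with hv
  have hvv : star v ⬝ᵥ v = 1 := by
    have := hK.isHermitian.eigenvectorBasis.orthonormal.1 i
    have h2 : inner ℂ (hK.isHermitian.eigenvectorBasis i) (hK.isHermitian.eigenvectorBasis i)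
        = (1 : ℂ) := by
      rw [inner_self_eq_norm_sq_to_K, this]; simp
    rw [EuclideanSpace.inner_eq_star_dotProduct, dotProduct_comm] at h2
    exact h2
  refine ⟨vecMulVec v (star v), posSemidef_vecMulVec_self_star v, ?_, ?_, ?_⟩
  · rw [vecMulVec_mul_vecMulVec, hvv, one_smul]
  · rw [trace_vecMulVec, dotProduct_comm, hvv]
  · rw [mul_vecMulVec, hv, hK.isHermitian.mulVec_eigenvectorBasis, ← hv, smul_vecMulVec,
      trace_smul, trace_vecMulVec, dotProduct_comm, hvv, hi]
    simp

theorem norm_le_trace_re {a : Type*} [Fintype a] [DecidableEq a] [Nonempty a]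
    {K : Op a} (hK : K.PosSemidef) : ‖K‖ ≤ K.trace.re := by
  obtain ⟨P, hP, hPP, -, h⟩ := exists_projection_trace_mul_eq_norm hK
  have hQ : (1 - P).PosSemidef := by
    have e : 1 - P = (1 - P)ᴴ * (1 - P) := by
      rw [(isHermitian_one.sub hP.isHermitian).eq, (IsIdempotentElem.one_sub hPP).eq]
    rw [e]
    exact posSemidef_conjTranspose_mul_self _
  have := trace_mul_re_nonneg hK hQ
  rw [mul_sub, mul_one, trace_sub, Complex.sub_re, h] at this
  linarith

theorem IsPOVM.one_le_sum_norm {a X : Type*} [Fintype a] [DecidableEq a] [Nonempty a]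
    [Fintype X] {E : X → Op a} (hE : IsPOVM E) : 1 ≤ ∑ x, ‖E x‖ := by
  have h : ‖∑ x, E x‖ ≤ ∑ x, ‖E x‖ := norm_sum_le _ _
  rwa [hE.2, CStarRing.norm_one] at h

theorem IsPOVM.sum_trace_re {a X : Type*} [Fintype a] [DecidableEq a] [Fintype X]
    {E : X → Op a} (hE : IsPOVM E) : ∑ x, (E x).trace.re = Fintype.card a := by
  rw [← Complex.re_sum, ← trace_sum, hE.2, trace_one]
  simp

theorem IsPOVM.sum_norm_le_card {a X : Type*} [Fintype a] [DecidableEq a] [Nonempty a]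
    [Fintype X] {E : X → Op a} (hE : IsPOVM E) : ∑ x, ‖E x‖ ≤ Fintype.card a := by
  rw [← hE.sum_trace_re]
  exact Finset.sum_le_sum fun x _ => norm_le_trace_re (hE.1 x)

/-- The robustness of `E` is at most `∑ x, ‖E x‖ - 1` (in fact equal to it): the noise
`(t x • 1 - E x) / r` with `t x ≥ ‖E x‖` makes `E` trivial. -/
theorem IsPOVM.robustness_add_one_le {a X : Type*} [Fintype a] [DecidableEq a] [Nonempty a]
    [Fintype X] {E : X → Op a} (hE : IsPOVM E) : robustness E + 1 ≤ ∑ x, ‖E x‖ := by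
  set S := ∑ x, ‖E x‖ with hS
  have hS1 : 1 ≤ S := hE.one_le_sum_norm
  rw [← le_sub_iff_add_le]
  -- Every `r > S - 1` is feasible; unlike `S - 1` itself, such an `r` is never zero.
  refine le_of_forall_gt_imp_ge_of_dense fun r hr => ?_
  have hr0 : 0 < r := by linarith
  refine csInf_le ⟨0, fun t ht => ht.1⟩ ⟨hr0.le,
    fun x => r⁻¹ • (((1 + r) * (‖E x‖ / S)) • (1 : Op a) - E x), fun x => ‖E x‖ / S,
    ⟨fun x => ?_, ?_⟩, fun x => by positivity, ?_, fun x => ?_⟩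
  · have h₁ : E x ≤ ‖E x‖ • (1 : Op a) := by
      have h := IsSelfAdjoint.le_algebraMap_norm_self (a := E x) (hE.1 x).isHermitian
      rwa [Algebra.algebraMap_eq_smul_one] at h
    have h₂ : ‖E x‖ • (1 : Op a) ≤ ((1 + r) * (‖E x‖ / S)) • (1 : Op a) := by
      refine smul_le_smul_of_nonneg_right ?_ zero_le_one
      rw [← mul_div_assoc, le_div_iff₀ (by linarith), mul_comm]
      exact mul_le_mul_of_nonneg_right (by linarith) (norm_nonneg _)
    rw [← nonneg_iff_posSemidef]
    exact smul_nonneg (inv_nonneg.mpr hr0.le) (sub_nonneg.mpr (h₁.trans h₂))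
  · rw [← Finset.smul_sum, Finset.sum_sub_distrib, hE.2, ← Finset.sum_smul, ← Finset.mul_sum,
      ← Finset.sum_div, ← hS, div_self (by linarith), mul_one, add_smul, one_smul,
      add_sub_cancel_left, smul_smul, inv_mul_cancel₀ hr0.ne', one_smul]
  · rw [← Finset.sum_div, ← hS, div_self (by linarith)]
  · rw [smul_smul, mul_inv_cancel₀ hr0.ne', one_smul, add_sub_cancel, smul_smul, ← mul_assoc,
      inv_mul_cancel₀ (by linarith), one_mul]

/-- A total map of completely positive maps inducing the POVM `K` has small entanglement
fidelity if the effects of `K` have large norm: probe the part of outcome `x` with the projection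
onto a top eigenvector of `K x`. -/
theorem IsPOVM.entFidelity_sum_le {a X : Type*} [Fintype a] [DecidableEq a] [Nonempty a]
    [Fintype X] {K : X → Op a} (hK : IsPOVM K) {J : X → SuperOp a a}
    (hJ : ∀ x, IsCompletelyPositive (J x)) (hJK : ∀ x M, (J x M).trace = (K x * M).trace)
    {s : ℝ} (hs : 0 < s) :
    (entFidelity (∑ x, J x)).re ≤ (1 + s) * ∑ x, ‖K x‖ +
      (1 + s⁻¹) * (((Fintype.card a : ℝ) - 1) * (Fintype.card a - ∑ x, ‖K x‖)) := by
  have key : ∀ x, (entFidelity (J x)).re ≤ (1 + s) * ‖K x‖ +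
      (1 + s⁻¹) * (((Fintype.card a : ℝ) - 1) * ((K x).trace.re - ‖K x‖)) := by
    intro x
    obtain ⟨P, hP, hPP, hPt, hPK⟩ := exists_projection_trace_mul_eq_norm (hK.1 x)
    have h := (hJ x).entFidelity_le hP.isHermitian hPP hs
    rw [hJK, hJK, hPK, mul_sub, mul_one, trace_sub, trace_sub, trace_one, hPt] at h
    simpa [hPK] using h
  calc (entFidelity (∑ x, J x)).re = ∑ x, (entFidelity (J x)).re := by
        rw [map_sum, Complex.re_sum]
    _ ≤ _ := Finset.sum_le_sum fun x _ => key x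
    _ = _ := by
      rw [Finset.sum_add_distrib, ← Finset.mul_sum, ← Finset.mul_sum, ← Finset.mul_sum,
        Finset.sum_sub_distrib, hK.sum_trace_re]

/-! ### Real inequalities -/

theorem le_add_sq_of_forall_pos {z p q : ℝ} (hp : 0 < p) (hq : 0 ≤ q)
    (h : ∀ s : ℝ, 0 < s → z ≤ (1 + s) * p ^ 2 + (1 + s⁻¹) * q ^ 2) : z ≤ (p + q) ^ 2 := by
  rcases hq.eq_or_lt with rfl | hq
  · refine le_of_forall_pos_le_add fun ε hε => ?_
    refine (h (ε / p ^ 2) (by positivity)).trans (le_of_eq ?_)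
    field_simp
    ring
  · refine (h (q / p) (by positivity)).trans (le_of_eq ?_)
    field_simp
    ring

/-- Optimising over `s` gives `F ≤ (u + w)²` with `u = √S` and `w = √((d - 1) (d - S))`. Since
`w² + (d - 1) u² = d (d - 1)`, `d² - (u + w)²` is a multiple of `((d - 1) u - w)²`. -/
theorem sq_sub_one_div_le {d S F : ℝ} (hd : 1 < d) (hS : 1 ≤ S) (hSd : S ≤ d)
    (h : ∀ s : ℝ, 0 < s → F ≤ (1 + s) * S + (1 + s⁻¹) * ((d - 1) * (d - S))) :
    (√S - 1) ^ 2 / (d - 1) ≤ 1 - F / d ^ 2 := by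
  set u := √S with hu
  set w := √((d - 1) * (d - S)) with hw
  have hu1 : 1 ≤ u := Real.one_le_sqrt.mpr hS
  have hw0 : 0 ≤ w := Real.sqrt_nonneg _
  have hu2 : u ^ 2 = S := Real.sq_sqrt (by linarith)
  have hw2 : w ^ 2 = (d - 1) * (d - S) :=
    Real.sq_sqrt (mul_nonneg (by linarith) (by linarith))
  have hF : F ≤ (u + w) ^ 2 :=
    le_add_sq_of_forall_pos (by linarith) hw0 (by rwa [hu2, hw2])
  have hsq : (d - 1) * (d ^ 2 - (u + w) ^ 2) = ((d - 1) * u - w) ^ 2 := by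
    linear_combination (-d) * hw2 + (d - d ^ 2) * hu2
  have huw : u + w ≤ d := by
    refine le_of_sq_le_sq ?_ (by linarith)
    nlinarith [sq_nonneg ((d - 1) * u - w)]
  have hmain : ((u - 1) * d) ^ 2 ≤ ((d - 1) * u - w) ^ 2 := by
    have : 0 ≤ (u - 1) * d := mul_nonneg (by linarith) (by linarith)
    gcongr
    linarith
  have hd1 : 0 < d - 1 := by linarith
  have hd0 : 0 < d ^ 2 := by positivity
  rw [div_le_iff₀ hd1, ← mul_le_mul_iff_left₀ hd0]
  have e : (1 - F / d ^ 2) * (d - 1) * d ^ 2 = (d - 1) * (d ^ 2 - F) := by field_simp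
  rw [e]
  nlinarith [mul_le_mul_of_nonneg_left hF hd1.le]

/-- The function `S ↦ 2 (√S - 1)² / (d - 1)` has slope at most one on `[1, d]`. -/
theorem two_mul_sq_sub_one_div_le_add {d S T ε : ℝ} (hd : 2 ≤ d) (hS : 1 ≤ S) (hSd : S ≤ d)
    (hT : 1 ≤ T) (hTd : T ≤ d) (hε : 0 ≤ ε) (h : S ≤ T + ε) :
    2 * (√S - 1) ^ 2 / (d - 1) ≤ ε + 2 * ((√T - 1) ^ 2 / (d - 1)) := by
  have hx1 : 1 ≤ √S := Real.one_le_sqrt.mpr hS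
  have hy1 : 1 ≤ √T := Real.one_le_sqrt.mpr hT
  have hxd : √S ≤ √d := Real.sqrt_le_sqrt hSd
  have hyd : √T ≤ √d := Real.sqrt_le_sqrt hTd
  have hx2 : √S ^ 2 = S := Real.sq_sqrt (by linarith)
  have hy2 : √T ^ 2 = T := Real.sq_sqrt (by linarith)
  have hd2 : √d ^ 2 = d := Real.sq_sqrt (by linarith)
  set x := √S
  set y := √T
  set D := √d
  have hd1 : 0 < d - 1 := by linarith
  rw [← mul_div_assoc, ← sub_le_iff_le_add, ← sub_div, div_le_iff₀ hd1]
  rcases le_total x y with hxy | hxy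
  · nlinarith [mul_nonneg hε hd1.le]
  · have hslope : 2 * (x + y - 2) ≤ (d - 1) * (x + y) := by
      rcases le_total 3 d with h3 | h3
      · nlinarith
      · have h₁ : (x + y) * (3 - d) ≤ (2 * D) * (3 - d) :=
          mul_le_mul_of_nonneg_right (by linarith) (by linarith)
        have h₂ : (2 * D) * (3 - d) ≤ 4 := by
          rw [← hd2]
          nlinarith [mul_nonneg (sq_nonneg (D - 1)) (by linarith : (0 : ℝ) ≤ D + 2)]
        linarith
    have h₁ := mul_le_mul_of_nonneg_left hslope (sub_nonneg.mpr hxy)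
    have h₂ : (d - 1) * (x ^ 2 - y ^ 2) ≤ (d - 1) * ε :=
      mul_le_mul_of_nonneg_left (by linarith) hd1.le
    nlinarith

end QuantumInfo

open QuantumInfo

theorem theorem3 {a b X : Type*} [Fintype a] [DecidableEq a] [Fintype b] [DecidableEq b]
    [Fintype X] (hd : 2 ≤ Fintype.card a)
    (E K : X → QuantumInfo.Op a) (hE : QuantumInfo.IsPOVM E) (hK : QuantumInfo.IsPOVM K)
    (Λ : QuantumInfo.SuperOp a b) (hΛ : QuantumInfo.IsChannel Λ)
    (hKΛ : QuantumInfo.IsCompatible Λ K) :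
    2 * (√(QuantumInfo.robustness E + 1) - 1) ^ 2 / ((Fintype.card a : ℝ) - 1) ≤
      QuantumInfo.povmError E K + QuantumInfo.disturbance Λ := by
  have : Nonempty a := Fintype.card_pos_iff.mp (by omega)
  have hd' : (2 : ℝ) ≤ Fintype.card a := by exact_mod_cast hd
  have hd1 : (0 : ℝ) < (Fintype.card a : ℝ) - 1 := by linarith
  obtain ⟨I, hI, rfl, hIK⟩ := hKΛ
  have hdist : 2 * ((√(∑ x, ‖K x‖) - 1) ^ 2 / ((Fintype.card a : ℝ) - 1)) ≤
      disturbance (∑ x, I x) := by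
    have : Nonempty {R : SuperOp b a // IsChannel R} := nonempty_subtype.mpr exists_isChannel
    refine le_ciInf fun ⟨R, hR⟩ => ?_
    refine le_trans ?_ (two_mul_one_sub_entFidelity_le_diamondDist (hR.comp hΛ))
    refine mul_le_mul_of_nonneg_left ?_ zero_le_two
    refine sq_sub_one_div_le (by linarith) hK.one_le_sum_norm hK.sum_norm_le_card fun s hs => ?_
    have hsum : R ∘ₗ (∑ x, I x) = ∑ x, R ∘ₗ I x := by
      ext M : 1
      simp
    rw [hsum]
    refine hK.entFidelity_sum_le (fun x => hR.1.comp (hI.1 x).1) (fun x M => ?_) hs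
    have h := hsAdjoint_spec (I x) 1 M
    rw [← hIK, (hK.1 x).isHermitian.eq, Matrix.conjTranspose_one, one_mul] at h
    rw [h]
    exact hR.2 _
  have hsum : ∑ x, ‖E x‖ ≤ ∑ x, ‖K x‖ + povmError E K := by
    rw [povmError, ← Finset.sum_add_distrib]
    exact Finset.sum_le_sum fun x _ => norm_le_norm_add_norm_sub' _ _
  have hε : 0 ≤ povmError E K := Finset.sum_nonneg fun x _ => norm_nonneg _
  have hrob : 0 ≤ robustness E := Real.sInf_nonneg fun r hr => hr.1
  have h1 : 1 ≤ √(robustness E + 1) := Real.one_le_sqrt.mpr (by linarith)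
  calc 2 * (√(robustness E + 1) - 1) ^ 2 / ((Fintype.card a : ℝ) - 1)
      ≤ 2 * (√(∑ x, ‖E x‖) - 1) ^ 2 / ((Fintype.card a : ℝ) - 1) := by
        have := Real.sqrt_le_sqrt hE.robustness_add_one_le
        gcongr
    _ ≤ povmError E K + 2 * ((√(∑ x, ‖K x‖) - 1) ^ 2 / ((Fintype.card a : ℝ) - 1)) :=
        two_mul_sq_sub_one_div_le_add hd' hE.one_le_sum_norm hE.sum_norm_le_card
          hK.one_le_sum_norm hK.sum_norm_le_card hε hsum
    _ ≤ _ := by gcongr
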